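/- Let $n\ge 1$ and let $X_1,\dots,X_n$ be independent random variables with a common continuous distribution function $F$. A feasible policy $\pi_n\in\Pi(n)$ observes $X_1,\dots,X_n$ one after the other and accepts or rejects each $X_i$ irrevocably when it is presented, so that the event that $X_i$ is accepted belongs to $\mathcal F_i=\sigma(X_1,\dots,X_i)$, in such a way that the accepted values, in their order of appearance $X_{\tau_1},\dots,X_{\tau_k}$, always form a unimodal sequence, i.e. $X_{\tau_1}\le\cdots\le X_{\tau_t}\ge X_{\tau_{t+1}}\ge\cdots\ge X_{\tau_k}$ for some $1\le t\le k$ (or nothing is accepted). Let $U^o_n(\pi_n)$ be the number of accepted observations, and call $\pi^*_n\in\Pi(n)$ optimal if $\mathbb E[U^o_n(\pi^*_n)]=\sup_{\pi_n\in\Pi(n)}\mathbb E[U^o_n(\pi_n)]$. Then an optimal policy $\pi^*_n\in\Pi(n)$ exists, it is unique in the sense that any two optimal policies almost surely accept the same observations, and it satisfies $$\operatorname{Var}[U^o_n(\pi^*_n)]\le \mathbb E[U^o_n(\pi^*_n)]<2\sqrt n .$$ -/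

import Mathlib

open MeasureTheory ProbabilityTheory

namespace UnimodalSelection

/-- The entries of `x` with indices in `S`, read in the order of the indices, first increase (weakly)
up to a turning place `t` and then decrease (weakly). Either piece may have size one, and the
empty selection is allowed. -/
def IsUnimodalOn {n : ℕ} (x : Fin n → ℝ) (S : Set (Fin n)) : Prop :=
  S = ∅ ∨ ∃ t ∈ S, MonotoneOn x (S ∩ Set.Iic t) ∧ AntitoneOn x (S ∩ Set.Ici t)

/-- The σ-field generated by the observations up to and including time `i`. -/
abbrev history {Ω : Type*} {n : ℕ} (X : Fin n → Ω → ℝ) (i : Fin n) : MeasurableSpace Ω :=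
  ⨆ j ≤ i, MeasurableSpace.comap (X j) inferInstance

/-- A feasible policy for the sequential selection of a unimodal subsequence of the observations
`X`: the decision to accept the `i`-th observation depends only on the observations up to
time `i`, it is final, and the accepted observations always form a unimodal subsequence. -/
structure Policy {Ω : Type*} {n : ℕ} (X : Fin n → Ω → ℝ) where
  /-- `accept i` is the event that the `i`-th observation is accepted. -/
  accept : Fin n → Set Ω
  adapted : ∀ i, MeasurableSet[history X i] (accept i)
  unimodal : ∀ ω, IsUnimodalOn (fun i => X i ω) {i | ω ∈ accept i}

/-- The length of the unimodal subsequence selected by the policy. -/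
noncomputable def Policy.length {Ω : Type*} {n : ℕ} {X : Fin n → Ω → ℝ} (π : Policy X) (ω : Ω) : ℝ :=
  ∑ i, (π.accept i).indicator (fun _ => (1 : ℝ)) ω

/-- The policy maximizes the expected length of the selected subsequence among all feasible
policies. -/
def Policy.IsOptimal {Ω : Type*} [MeasurableSpace Ω] {n : ℕ} {X : Fin n → Ω → ℝ}
    (μ : Measure Ω) (π : Policy X) : Prop :=
  ∀ π' : Policy X, ∫ ω, π'.length ω ∂μ ≤ ∫ ω, π.length ω ∂μ

end UnimodalSelection

/-! Apply `F` to make the observations uniform, and encode the past of a unimodal selection in one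
number `r` of `[0, 2]`: the room still left on a path that climbs from 0 to 1 and then descends.
Acceptance lowers `r`. Continuing the climb leaves more room than turning, so `next` turns only when
it must. The problem becomes a Markov decision problem with value function `value k r`, starting
from `r = 2`.

Existence and uniqueness: for any feasible selection, the acceptances so far plus the value of the
future (`potential`) lose in expectation exactly the nonnegative `loss` at each step. Hence the mean
length is `value n 2` minus the total expected loss, and optimality means that all losses vanish
almost surely. Strict monotonicity of the value function makes ties null events (`ae_no_tie`), so a
lossless selection follows `Take` almost surely; conversely, following `Take` is feasible and
lossless.

Mean: for every `l > 0`, the function `k * l / 2 + r / l` strictly dominates the value function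
(`value_lt_affine`); at `r = 2`, the choice `l = 2 / √n` gives `2 * √n`.

Variance: under an optimal policy the potential is a martingale. Relative to the value of rejection,
an offer changes it by an amount between 0 and the indicator of acceptance, so its second moment
grows at each step by at most the probability of acceptance. Summation bounds the variance of the
length by its mean. -/

namespace UnimodalSelection

/-! ### The state space and the Bellman recursion -/

/-- The uniform distribution on the unit interval. -/
noncomputable def uniform01 : Measure ℝ := volume.restrict (Set.Icc 0 1)

instance : IsProbabilityMeasure uniform01 := ⟨by simp [uniform01]⟩

instance : NullSingletonClass uniform01 := by unfold uniform01; infer_instance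

lemma ae_uniform01 : ∀ᵐ u ∂uniform01, u ∈ Set.Icc (0 : ℝ) 1 := by
  unfold uniform01
  exact ae_restrict_mem measurableSet_Icc

/-- The state of a selection is a number in `[0, 2]`: the state `2 - u` with `u ≤ 1` means that
the selection is increasing with last value `u`, the state `u < 1` that it has started to decrease
and has last value `u`. This is the state after acceptance of the value `u` in the state `r`. -/
noncomputable def next (r u : ℝ) : ℝ := if 2 - u ≤ r then 2 - u else u

/-- The value of being offered `u` in the state `r`, when `V` is the value of the remaining
offers. -/
noncomputable def gain (V : ℝ → ℝ) (r u : ℝ) : ℝ :=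
  if next r u ≤ r then max (V r) (1 + V (next r u)) else V r

/-- The optimal expected number of acceptances in the state `r` with `k` offers remaining. -/
noncomputable def value : ℕ → ℝ → ℝ
  | 0 => fun _ => 0
  | k + 1 => fun r => ∫ u, gain (value k) r u ∂uniform01

lemma next_mono {r r' u : ℝ} (h : r ≤ r') (hu : u ≤ 1) : next r u ≤ next r' u := by
  unfold next; split_ifs <;> linarith

lemma next_le_mono {r r' u : ℝ} (h : r ≤ r') (hr : next r u ≤ r) : next r' u ≤ r' := by
  unfold next at *; split_ifs at * <;> linarith

lemma next_mem {r u : ℝ} (hu : u ∈ Set.Icc (0 : ℝ) 1) : next r u ∈ Set.Icc (0 : ℝ) 2 := by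
  obtain ⟨h0, h1⟩ := hu
  unfold next; split_ifs <;> constructor <;> linarith

lemma measurable_next : Measurable fun p : ℝ × ℝ => next p.1 p.2 := by
  unfold next
  refine Measurable.ite (measurableSet_le (by fun_prop) (by fun_prop)) (by fun_prop) (by fun_prop)

lemma le_gain (V : ℝ → ℝ) (r u : ℝ) : V r ≤ gain V r u := by
  unfold gain; split_ifs <;> simp

lemma one_add_le_gain (V : ℝ → ℝ) {r u : ℝ} (h : next r u ≤ r) :
    1 + V (next r u) ≤ gain V r u := by
  unfold gain; rw [if_pos h]; exact le_max_right _ _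

/-- More room keeps every feasible offer feasible and leaves at least as much room after acceptance.
-/
lemma gain_mono {V : ℝ → ℝ} (hV : Monotone V) {r r' u : ℝ} (h : r ≤ r') (hu : u ≤ 1) :
    gain V r u ≤ gain V r' u := by
  unfold gain
  by_cases h1 : next r u ≤ r
  · rw [if_pos h1, if_pos (next_le_mono h h1)]
    exact max_le_max (hV h) (by linarith [hV (next_mono h hu)])
  · rw [if_neg h1]
    exact (hV h).trans (le_gain V r' u)

lemma gain_le {V : ℝ → ℝ} {c : ℝ} (h : ∀ r, V r ≤ c) (r u : ℝ) : gain V r u ≤ 1 + c := by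
  unfold gain; split_ifs
  · exact max_le (by linarith [h r]) (by linarith [h (next r u)])
  · linarith [h r]

lemma measurable_gain {V : ℝ → ℝ} (hV : Measurable V) :
    Measurable fun p : ℝ × ℝ => gain V p.1 p.2 := by
  unfold gain
  exact Measurable.ite (measurableSet_le measurable_next measurable_fst)
    ((hV.comp measurable_fst).max ((hV.comp measurable_next).const_add 1))
    (hV.comp measurable_fst)

lemma integrable_gain {V : ℝ → ℝ} {c : ℝ} (hm : Monotone V) (h0 : ∀ r, 0 ≤ V r) (h1 : ∀ r, V r ≤ c)
    (r : ℝ) : Integrable (gain V r) uniform01 := by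
  refine Integrable.of_bound (C := 1 + c)
    ((measurable_gain hm.measurable).comp measurable_prodMk_left).aestronglyMeasurable
    (.of_forall fun u => ?_)
  rw [Real.norm_eq_abs, abs_of_nonneg ((h0 r).trans (le_gain _ r u))]
  exact gain_le h1 r u

lemma value_props (k : ℕ) :
    Monotone (value k) ∧ (∀ r, 0 ≤ value k r) ∧ ∀ r, value k r ≤ k := by
  induction k with
  | zero => exact ⟨fun _ _ _ => le_rfl, fun _ => le_rfl, fun _ => by simp [value]⟩
  | succ k ih =>
    obtain ⟨hm, h0, h1⟩ := ih
    have hi := integrable_gain hm h0 h1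
    refine ⟨fun r r' h => ?_, fun r => ?_, fun r => ?_⟩
    · refine integral_mono_ae (hi r) (hi r') ?_
      filter_upwards [ae_uniform01] with u hu
      exact gain_mono hm h hu.2
    · exact integral_nonneg fun u => (h0 r).trans (le_gain _ r u)
    · calc value (k + 1) r ≤ ∫ _, (1 + k : ℝ) ∂uniform01 :=
            integral_mono (hi r) (integrable_const _) fun u => gain_le h1 r u
        _ = (k + 1 : ℕ) := by simp [add_comm]

lemma value_mono (k : ℕ) : Monotone (value k) := (value_props k).1

lemma value_nonneg (k : ℕ) (r : ℝ) : 0 ≤ value k r := (value_props k).2.1 r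

lemma value_le (k : ℕ) (r : ℝ) : value k r ≤ k := (value_props k).2.2 r

lemma measurable_value (k : ℕ) : Measurable (value k) := (value_mono k).measurable

lemma integrable_gain_value (k : ℕ) (r : ℝ) : Integrable (gain (value k) r) uniform01 :=
  integrable_gain (value_mono k) (value_nonneg k) (value_le k) r

/-! ### Strict monotonicity of the value and absence of ties -/

lemma exists_mem_Ioo_of_ae_uniform01 {p : ℝ → Prop} (h : ∀ᵐ u ∂uniform01, p u) {a b : ℝ}
    (ha : 0 ≤ a) (hab : a < b) (hb : b ≤ 1) : ∃ u ∈ Set.Ioo a b, p u := by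
  by_contra! hc
  have h1 : uniform01 (Set.Ioo a b) = 0 := measure_mono_null (fun u hu => hc u hu) h
  rw [uniform01, Measure.restrict_apply measurableSet_Ioo, Set.inter_eq_left.2, Real.volume_Ioo,
    ENNReal.ofReal_eq_zero] at h1
  · linarith
  · exact fun u hu => ⟨ha.trans hu.1.le, hu.2.le.trans hb⟩

/-- The gains are ordered almost everywhere, so equal integrals would make them equal almost
everywhere, which an interval of strict inequality forbids. -/
lemma value_succ_lt {k : ℕ} {r r' a b : ℝ} (h : r ≤ r') (ha : 0 ≤ a) (hab : a < b) (hb : b ≤ 1)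
    (hlt : ∀ u ∈ Set.Ioo a b, gain (value k) r u < gain (value k) r' u) :
    value (k + 1) r < value (k + 1) r' := by
  refine lt_of_le_of_ne (value_mono _ h) fun he => ?_
  have hle : gain (value k) r ≤ᵐ[uniform01] gain (value k) r' := by
    filter_upwards [ae_uniform01] with u hu
    exact gain_mono (value_mono k) h hu.2
  have heq := (integral_eq_iff_of_ae_le (integrable_gain_value k r)
    (integrable_gain_value k r') hle).1 he
  obtain ⟨u, hu, hu'⟩ := exists_mem_Ioo_of_ae_uniform01 heq ha hab hb
  exact (hlt u hu).ne hu'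

/-- With at least one offer remaining, the value increases strictly while the selection
decreases. -/
lemma value_succ_lt_of_lt_one (k : ℕ) {r r' : ℝ} (h0 : 0 ≤ r) (h1 : r < 1) (h : r < r') :
    value (k + 1) r < value (k + 1) r' := by
  -- Offers in this interval are infeasible in the state `r`, but feasible in `r'`, where acceptance
  -- leaves at least the room `r`.
  refine value_succ_lt h.le h0 (lt_min h h1) (min_le_right _ _) fun u hu => ?_
  have hr := hu.1
  have hu1 : u < r' := hu.2.trans_le (min_le_left _ _)
  have hu2 : u < 1 := hu.2.trans_le (min_le_right _ _)
  have e : gain (value k) r u = value k r := by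
    unfold gain
    rw [if_neg]
    unfold next
    split_ifs <;> linarith
  have hn : r ≤ next r' u ∧ next r' u ≤ r' := by
    unfold next; split_ifs <;> constructor <;> linarith
  have := one_add_le_gain (value k) hn.2
  linarith [value_mono k hn.1]

/-- With at least two offers remaining, the value increases strictly while the selection
increases. -/
lemma value_add_two_lt_of_one_le (k : ℕ) {r r' : ℝ} (h1 : 1 ≤ r) (h : r < r') (h2 : r' ≤ 2) :
    value (k + 2) r < value (k + 2) r' := by
  -- These offers continue the climb from `r'` but force the turn from `r`. A remaining offer is
  -- needed afterwards for the difference to count.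
  refine value_succ_lt h.le (a := 2 - r') (b := 2 - r) (by linarith) (by linarith) (by linarith)
    fun u hu => ?_
  obtain ⟨hu1, hu2⟩ := hu
  have e : next r u = u := if_neg (by linarith)
  have e' : next r' u = 2 - u := if_pos (by linarith)
  have g := one_add_le_gain (value (k + 1)) (r := r') (u := u) (by rw [e']; linarith)
  rw [e'] at g
  have m1 : value (k + 1) r ≤ value (k + 1) (2 - u) := value_mono _ (by linarith)
  have m2 : value (k + 1) u < value (k + 1) (2 - u) :=
    value_succ_lt_of_lt_one k (by linarith) (by linarith) (by linarith)
  refine lt_of_lt_of_le ?_ g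
  unfold gain
  split_ifs
  · rw [e]; exact max_lt (by linarith) (by linarith)
  · linarith

/-- Two solutions would contradict strict monotonicity, except on `[1, 2]` when at most one offer
remains; there the size of the value excludes a solution. -/
lemma subsingleton_value_eq_sub_one (k : ℕ) (r : ℝ) :
    {y ∈ Set.Icc (0 : ℝ) 2 | value k r = 1 + value k y}.Subsingleton := by
  suffices ∀ y ∈ Set.Icc (0 : ℝ) 2, ∀ z ∈ Set.Icc (0 : ℝ) 2, y < z →
      value k r = 1 + value k y → value k r = 1 + value k z → False by
    rintro y ⟨hy, hy'⟩ z ⟨hz, hz'⟩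
    by_contra hne
    rcases lt_or_gt_of_ne hne with h | h
    · exact this y hy z hz h hy' hz'
    · exact this z hz y hy h hz' hy'
  intro y hy z hz hyz ey ez
  match k with
  | 0 => simp [value] at ey
  | k + 1 =>
    rcases lt_or_ge y 1 with h | h
    · linarith [value_succ_lt_of_lt_one k hy.1 h hyz]
    match k with
    -- With one offer left the value is at most 1, but positive at `y ≥ 1`, so `1 + value 1 y` is
    -- out of reach.
    | 0 =>
      have := value_succ_lt_of_lt_one 0 le_rfl zero_lt_one (zero_lt_one.trans_le h)
      have h1 := value_le (0 + 1) r
      have h0 := value_nonneg (0 + 1) 0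
      push_cast at h1
      linarith
    | k + 1 => linarith [value_add_two_lt_of_one_le k h hyz hz.2]

/-- Acceptance and rejection of a uniform offer have different values almost surely. -/
lemma ae_no_tie (k : ℕ) (r : ℝ) :
    ∀ᵐ u ∂uniform01, next r u ≠ r ∧ value k r ≠ 1 + value k (next r u) := by
  -- The next state is `u` or `2 - u`, so bad offers lie in a finite set or its reflection; `r` is
  -- inserted to exclude `next r u = r`.
  set S : Set ℝ := {y ∈ Set.Icc (0 : ℝ) 2 | value k r = 1 + value k y} with hS
  have hf : (insert r S).Finite := (subsingleton_value_eq_sub_one k r).finite.insert r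
  have hf' := hf.preimage (f := fun u : ℝ => 2 - u) (by intro a _ b _ h; simpa using h)
  filter_upwards [ae_uniform01, measure_eq_zero_iff_ae_notMem.1 (hf.measure_zero uniform01),
    measure_eq_zero_iff_ae_notMem.1 (hf'.measure_zero uniform01)] with u hu h1 h2
  have h3 : next r u ∉ insert r S := by
    unfold next; split_ifs
    · exact h2
    · exact h1
  rw [Set.mem_insert_iff, not_or] at h3
  exact ⟨h3.1, fun h => h3.2 ⟨next_mem hu, h⟩⟩

/-! ### The affine upper bound for the value -/

lemma integral_posPart_one_sub_div {l a b : ℝ} (hl : 0 < l) (hab : a ≤ b) :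
    ∫ y in a..b, max 0 (1 - y / l) = l / 2 * (max 0 (1 - a / l) ^ 2 - max 0 (1 - b / l) ^ 2) := by
  -- The kink at `y = l` is the one point left out of the derivative computation.
  have := integral_eq_of_hasDerivAt_off_countable_of_le
    (fun y => - (l / 2) * max 0 (1 - y / l) ^ 2) (fun y => max 0 (1 - y / l)) hab
    (Set.countable_singleton l) (by fun_prop) ?_ (Continuous.intervalIntegrable (by fun_prop) _ _)
  · rw [this]; ring
  rintro x ⟨-, hx⟩
  rcases lt_or_gt_of_ne (show x ≠ l from hx) with h | h
  · have h1 : 0 < 1 - x / l := by rw [sub_pos, div_lt_one hl]; exact h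
    rw [max_eq_right h1.le]
    have hd : HasDerivAt (fun y => - (l / 2) * (1 - y / l) ^ 2) (1 - x / l) x := by
      have := ((((hasDerivAt_id x).div_const l).const_sub 1).pow 2).const_mul (-(l / 2))
      refine this.congr_deriv ?_
      simp
      field_simp
    refine hd.congr_of_eventuallyEq ?_
    filter_upwards [eventually_lt_nhds h] with y hy
    rw [max_eq_right]
    rw [sub_nonneg, div_le_one hl]; exact hy.le
  · have h1 : 1 - x / l ≤ 0 := by rw [sub_nonpos, one_le_div hl]; exact le_of_lt h
    rw [max_eq_left h1]
    refine (hasDerivAt_const x (0 : ℝ)).congr_of_eventuallyEq ?_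
    filter_upwards [eventually_gt_nhds h] with y hy
    have h2 : 1 - y / l ≤ 0 := by rw [sub_nonpos, one_le_div hl]; exact le_of_lt hy
    simp [max_eq_left h2]

/-- The positive part of the gain of an acceptance, when the value is an affine function of the
state with slope `1 / l`. -/
noncomputable def linearGain (l r u : ℝ) : ℝ :=
  if next r u ≤ r then max 0 (1 - (r - next r u) / l) else 0

lemma integrable_linearGain {l : ℝ} (hl : 0 < l) (r : ℝ) {ν : Measure ℝ} [IsFiniteMeasure ν] :
    Integrable (linearGain l r) ν := by
  have hm : Measurable (next r) := measurable_next.comp measurable_prodMk_left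
  refine Integrable.of_bound (C := 1) (Measurable.aestronglyMeasurable ?_) (.of_forall fun u => ?_)
  · unfold linearGain
    exact Measurable.ite (measurableSet_le hm measurable_const) (by fun_prop) measurable_const
  · unfold linearGain
    split_ifs with h
    · rw [Real.norm_eq_abs, abs_of_nonneg (le_max_left _ _)]
      have : 0 ≤ (r - next r u) / l := div_nonneg (by linarith) hl.le
      exact max_le zero_le_one (by linarith)
    · simp

/-- In terms of the room `y` used up, the integral is at most that of `max 0 (1 - y / l)` over part
of the half-line `y ≥ 0`, whose total is `l / 2`. -/
lemma integral_linearGain_le {l r : ℝ} (hl : 0 < l) (h0 : 0 ≤ r) (h2 : r ≤ 2) :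
    ∫ u, linearGain l r u ∂uniform01 ≤ l / 2 := by
  have hint : ∀ a b : ℝ, IntervalIntegrable (linearGain l r) volume a b := fun a b =>
    ⟨integrable_linearGain hl r, integrable_linearGain hl r⟩
  have hφ : ∀ {f : ℝ → ℝ} (_ : Continuous f) (a b : ℝ),
      IntervalIntegrable f volume a b := fun hf a b => hf.intervalIntegrable a b
  rw [uniform01, integral_Icc_eq_integral_Ioc, ← intervalIntegral.integral_of_le zero_le_one]
  rcases lt_or_ge r 1 with hr | hr
  · rw [← intervalIntegral.integral_add_adjacent_intervals (hint 0 r) (hint r 1)]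
    have e1 : ∫ u in (0 : ℝ)..r, linearGain l r u ≤ ∫ u in (0 : ℝ)..r, max 0 (1 - (r - u) / l) := by
      refine intervalIntegral.integral_mono_on_of_le_Ioo h0 (hint _ _) (hφ (by fun_prop) _ _) ?_
      rintro u ⟨hu0, hu1⟩
      have : next r u = u := if_neg (by linarith)
      rw [linearGain, this, if_pos hu1.le]
    have e2 : ∫ u in r..(1 : ℝ), linearGain l r u ≤ ∫ u in r..(1 : ℝ), (0 : ℝ) := by
      refine intervalIntegral.integral_mono_on_of_le_Ioo hr.le (hint _ _) (hφ (by fun_prop) _ _) ?_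
      rintro u ⟨hu0, hu1⟩
      have : next r u = u := if_neg (by linarith)
      rw [linearGain, this, if_neg (by linarith)]
    rw [intervalIntegral.integral_comp_sub_left (fun y => max 0 (1 - y / l)),
      integral_posPart_one_sub_div hl (by linarith)] at e1
    simp only [sub_self, zero_div, sub_zero, zero_le_one, sup_of_le_right, one_pow,
      intervalIntegral.integral_zero] at e1 e2
    nlinarith [sq_nonneg (max 0 (1 - r / l))]
  · rw [← intervalIntegral.integral_add_adjacent_intervals (hint 0 (2 - r)) (hint (2 - r) 1)]
    -- Turning costs the room `r - u`. The smaller `1 - u` runs over `[r - 1, 1]`, which adjoins the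
    -- range `[0, r - 1]` of the cost of climbing, so the two bounds telescope.
    have e1 : ∫ u in (0 : ℝ)..(2 - r), linearGain l r u ≤
        ∫ u in (0 : ℝ)..(2 - r), max 0 (1 - (1 - u) / l) := by
      refine intervalIntegral.integral_mono_on_of_le_Ioo (by linarith) (hint _ _)
        (hφ (by fun_prop) _ _) ?_
      rintro u ⟨hu0, hu1⟩
      have : next r u = u := if_neg (by linarith)
      rw [linearGain, this, if_pos (by linarith)]
      gcongr
    have e2 : ∫ u in (2 - r)..(1 : ℝ), linearGain l r u ≤
        ∫ u in (2 - r)..(1 : ℝ), max 0 (1 - (u - (2 - r)) / l) := by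
      refine intervalIntegral.integral_mono_on_of_le_Ioo (by linarith) (hint _ _)
        (hφ (by fun_prop) _ _) ?_
      rintro u ⟨hu0, hu1⟩
      have : next r u = 2 - u := if_pos (by linarith)
      rw [linearGain, this, if_pos (by linarith), show r - (2 - u) = u - (2 - r) by ring]
    rw [intervalIntegral.integral_comp_sub_left (fun y => max 0 (1 - y / l)),
      integral_posPart_one_sub_div hl (by linarith)] at e1
    rw [intervalIntegral.integral_comp_sub_right (fun y => max 0 (1 - y / l)),
      integral_posPart_one_sub_div hl (by linarith)] at e2
    simp only [sub_self, zero_div, sub_zero, zero_le_one, sup_of_le_right, one_pow] at e1 e2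
    nlinarith [sq_nonneg (max 0 (1 - 1 / l))]

/-- The affine bound is a supersolution of the Bellman recursion: one more offer adds at most the
mean of `linearGain`, that is `l / 2`. -/
lemma value_lt_affine {l : ℝ} (hl : 0 < l) (k : ℕ) {r : ℝ} (h0 : 0 < r) (h2 : r ≤ 2) :
    value k r < k * l / 2 + r / l := by
  induction k generalizing r with
  | zero => simpa [value] using div_pos h0 hl
  | succ k ih =>
    have hi : Integrable (fun u => k * l / 2 + r / l + linearGain l r u) uniform01 :=
      (integrable_const _).add (integrable_linearGain hl r)
    have hlt : ∀ᵐ u ∂uniform01, gain (value k) r u < k * l / 2 + r / l + linearGain l r u := by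
      -- The offer 0 is discarded because the strict induction hypothesis needs a positive next
      -- state.
      filter_upwards [ae_uniform01,
        measure_eq_zero_iff_ae_notMem.1 (measure_singleton (μ := uniform01) 0)] with u hu hu0
      have hpos : 0 < u := lt_of_le_of_ne hu.1 fun h => hu0 h.symm
      have hn : 0 < next r u := by unfold next; split_ifs <;> linarith [hu.2]
      unfold gain linearGain
      split_ifs with h
      · have h3 := ih h0 h2
        have h4 := ih hn (next_mem hu).2
        have h5 := le_max_left 0 (1 - (r - next r u) / l)
        have h6 := le_max_right 0 (1 - (r - next r u) / l)
        rw [sub_div] at h6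
        rw [sub_div] at h5 ⊢
        exact max_lt (by linarith) (by linarith)
      · linarith [ih h0 h2]
    have hle : gain (value k) r ≤ᵐ[uniform01] fun u => k * l / 2 + r / l + linearGain l r u :=
      hlt.mono fun _ => le_of_lt
    have hstep : value (k + 1) r < ∫ u, (k * l / 2 + r / l + linearGain l r u) ∂uniform01 := by
      refine lt_of_le_of_ne (integral_mono_ae (integrable_gain_value k r) hi hle) fun he => ?_
      have heq := (integral_eq_iff_of_ae_le (integrable_gain_value k r) hi hle).1 he
      obtain ⟨u, h, h'⟩ := (hlt.and heq).exists
      exact h.ne h'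
    rw [integral_add (integrable_const _) (integrable_linearGain hl r)] at hstep
    have := integral_linearGain_le hl h0.le h2
    simp only [integral_const, probReal_univ, smul_eq_mul, one_mul] at hstep
    push_cast
    linarith

lemma value_two_lt {n : ℕ} (hn : 1 ≤ n) : value n 2 < 2 * √n := by
  have hs : 0 < √(n : ℝ) := Real.sqrt_pos.2 (by exact_mod_cast hn)
  -- This `l` minimizes `n * l / 2 + 2 / l`.
  have h := value_lt_affine (l := 2 / √n) (by positivity) n two_pos le_rfl
  have e : (n : ℝ) * (2 / √n) / 2 + 2 / (2 / √n) = 2 * √n := by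
    have := Real.mul_self_sqrt (Nat.cast_nonneg (α := ℝ) n)
    field_simp
    nlinarith
  linarith

/-! ### Feasible selections and their losses -/

/-- Before time `n`, the offers `U` are uniform on the unit interval and independent of the past,
which is described by the filtration `m`. -/
structure IsUniformOffers {Ω : Type*} [m0 : MeasurableSpace Ω] (μ : Measure Ω) (n : ℕ)
    (U : ℕ → Ω → ℝ) (m : ℕ → MeasurableSpace Ω) : Prop where
  le : ∀ i, m i ≤ m0
  mono : Monotone m
  mem : ∀ i ω, U i ω ∈ Set.Icc (0 : ℝ) 1
  meas : ∀ i, Measurable[m (i + 1)] (U i)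
  map : ∀ i < n, μ.map (U i) = uniform01
  indep : ∀ i < n, Indep (m i) (MeasurableSpace.comap (U i) inferInstance) μ

/-- Acceptance of `u` in the state `r` is feasible and strictly better than rejection when `k`
offers remain afterwards. -/
def Take (k : ℕ) (r u : ℝ) : Prop := next r u < r ∧ value k r < 1 + value k (next r u)

lemma measurableSet_no_tie (k : ℕ) : MeasurableSet {x : ℝ × ℝ |
    next x.1 x.2 ≠ x.1 ∧ value k x.1 ≠ 1 + value k (next x.1 x.2)} := by
  refine MeasurableSet.inter (measurableSet_eq_fun measurable_next measurable_fst).compl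
    (measurableSet_eq_fun ?_ ?_).compl
  · exact (measurable_value k).comp measurable_fst
  · exact ((measurable_value k).comp measurable_next).const_add 1

lemma measurableSet_take (k : ℕ) : MeasurableSet {x : ℝ × ℝ | Take k x.1 x.2} := by
  simp only [Take, Set.ofPred_and]
  refine MeasurableSet.inter (measurableSet_lt measurable_next measurable_fst)
    (measurableSet_lt ?_ ?_)
  · exact (measurable_value k).comp measurable_fst
  · exact ((measurable_value k).comp measurable_next).const_add 1

section Selection

variable {Ω : Type*}

open Classical in
/-- The state at time `i`, when the offers in the events `A` are accepted. -/
noncomputable def state (U : ℕ → Ω → ℝ) (A : ℕ → Set Ω) : ℕ → Ω → ℝ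
  -- The start is a climb with last value 0, which restricts nothing.
  | 0 => fun _ => 2
  | i + 1 => fun ω => if ω ∈ A i then next (state U A i ω) (U i ω) else state U A i ω

/-- The number of acceptances before time `i`. -/
noncomputable def count (A : ℕ → Set Ω) (i : ℕ) (ω : Ω) : ℝ :=
  ∑ j ∈ Finset.range i, (A j).indicator (fun _ => (1 : ℝ)) ω

/-- The acceptance events `A` are adapted to the filtration `m`, and only feasible offers are
accepted. -/
structure IsFeasible (U : ℕ → Ω → ℝ) (m : ℕ → MeasurableSpace Ω) (A : ℕ → Set Ω) : Prop where
  adapted : ∀ i, MeasurableSet[m (i + 1)] (A i)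
  next_le : ∀ i, ∀ ω ∈ A i, next (state U A i ω) (U i ω) ≤ state U A i ω

/-- The acceptances before time `i` plus the optimal expected number of later acceptances. -/
noncomputable def potential (n : ℕ) (U : ℕ → Ω → ℝ) (A : ℕ → Set Ω) (i : ℕ) (ω : Ω) : ℝ :=
  count A i ω + value (n - i) (state U A i ω)

/-- The loss caused by a decision at time `i` that differs from the optimal one. -/
noncomputable def loss (n : ℕ) (U : ℕ → Ω → ℝ) (A : ℕ → Set Ω) (i : ℕ) (ω : Ω) : ℝ :=
  gain (value (n - (i + 1))) (state U A i ω) (U i ω) -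
    ((A i).indicator (fun _ => (1 : ℝ)) ω + value (n - (i + 1)) (state U A (i + 1) ω))

variable {U : ℕ → Ω → ℝ} {m : ℕ → MeasurableSpace Ω} {A B : ℕ → Set Ω} {n i : ℕ}

lemma count_succ (ω : Ω) :
    count A (i + 1) ω = count A i ω + (A i).indicator (fun _ => (1 : ℝ)) ω :=
  Finset.sum_range_succ _ _

lemma state_succ_of_mem {ω : Ω} (h : ω ∈ A i) :
    state U A (i + 1) ω = next (state U A i ω) (U i ω) := if_pos h

lemma state_succ_of_notMem {ω : Ω} (h : ω ∉ A i) : state U A (i + 1) ω = state U A i ω := if_neg h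

lemma count_nonneg (A : ℕ → Set Ω) (i : ℕ) (ω : Ω) : 0 ≤ count A i ω :=
  Finset.sum_nonneg fun _ _ => Set.indicator_nonneg (fun _ _ => zero_le_one) _

lemma count_le (A : ℕ → Set Ω) (i : ℕ) (ω : Ω) : count A i ω ≤ i := by
  refine (Finset.sum_le_card_nsmul _ _ 1 fun j _ => ?_).trans (by simp)
  exact Set.indicator_le_self' (fun _ _ => zero_le_one) _

lemma loss_nonneg (hA : IsFeasible U m A) (n i : ℕ) (ω : Ω) : 0 ≤ loss n U A i ω := by
  unfold loss
  by_cases h : ω ∈ A i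
  · rw [state_succ_of_mem h, Set.indicator_of_mem h, sub_nonneg]
    exact one_add_le_gain _ (hA.next_le i ω h)
  · rw [state_succ_of_notMem h, Set.indicator_of_notMem h, sub_nonneg, zero_add]
    exact le_gain _ _ _

lemma loss_of_mem {ω : Ω} (h : ω ∈ A i) : loss n U A i ω =
    gain (value (n - (i + 1))) (state U A i ω) (U i ω) -
      (1 + value (n - (i + 1)) (next (state U A i ω) (U i ω))) := by
  rw [loss, state_succ_of_mem h, Set.indicator_of_mem h]

lemma loss_of_notMem {ω : Ω} (h : ω ∉ A i) : loss n U A i ω =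
    gain (value (n - (i + 1))) (state U A i ω) (U i ω) -
      value (n - (i + 1)) (state U A i ω) := by
  rw [loss, state_succ_of_notMem h, Set.indicator_of_notMem h, zero_add]

lemma gain_of_take {k : ℕ} {r u : ℝ} (h : Take k r u) :
    gain (value k) r u = 1 + value k (next r u) := by
  rw [gain, if_pos h.1.le, max_eq_right h.2.le]

lemma gain_of_not_take {k : ℕ} {r u : ℝ} (h : ¬ Take k r u) (hr : next r u ≠ r) :
    gain (value k) r u = value k r := by
  unfold gain
  split_ifs with h1
  · refine max_eq_left (not_lt.1 fun h2 => h ⟨lt_of_le_of_ne h1 hr, h2⟩)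
  · rfl

/-- Away from ties, a decision is optimal if and only if it follows `Take`. -/
lemma loss_eq_zero_iff {ω : Ω}
    (h1 : next (state U A i ω) (U i ω) ≠ state U A i ω)
    (h2 : value (n - (i + 1)) (state U A i ω) ≠
      1 + value (n - (i + 1)) (next (state U A i ω) (U i ω))) :
    loss n U A i ω = 0 ↔ (ω ∈ A i ↔ Take (n - (i + 1)) (state U A i ω) (U i ω)) := by
  by_cases ht : Take (n - (i + 1)) (state U A i ω) (U i ω)
  · have hg := gain_of_take ht
    by_cases h : ω ∈ A i
    · simp [loss_of_mem h, hg, h, ht]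
    · simp only [loss_of_notMem h, hg, h, ht, iff_true, iff_false]
      intro h3
      exact h2 (by linarith)
  · have hg := gain_of_not_take ht h1
    by_cases h : ω ∈ A i
    · simp only [loss_of_mem h, hg, h, ht, iff_false, not_true, iff_false]
      intro h3
      exact h2 (by linarith)
    · simp [loss_of_notMem h, hg, h, ht]

lemma measurable_state (hm : Monotone m) (hU : ∀ i, Measurable[m (i + 1)] (U i))
    (hA : ∀ i, MeasurableSet[m (i + 1)] (A i)) (i : ℕ) : Measurable[m i] (state U A i) := by
  induction i with
  | zero => exact @measurable_const _ _ _ (m 0) _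
  | succ i ih =>
    have ih' : Measurable[m (i + 1)] (state U A i) := ih.mono (hm i.le_succ) le_rfl
    have h : Measurable[m (i + 1)] fun ω => next (state U A i ω) (U i ω) :=
      measurable_next.comp (ih'.prodMk (hU i))
    classical
    exact Measurable.ite (m := m (i + 1)) (p := (· ∈ A i)) (hA i) h ih'

lemma measurable_count (hm : Monotone m) (hA : ∀ i, MeasurableSet[m (i + 1)] (A i)) (i : ℕ) :
    Measurable[m i] (count A i) := by
  unfold count
  refine Finset.measurable_fun_sum (m := m i) _ fun j hj => ?_
  exact (@measurable_const _ _ _ (m i) 1).indicator (hm (Finset.mem_range.1 hj) _ (hA j))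

lemma potential_self (ω : Ω) : potential n U A n ω = count A n ω := by
  simp [potential, value]

lemma potential_zero (ω : Ω) : potential n U A 0 ω = value n 2 := by
  simp [potential, count, state]

lemma potential_succ_add_loss (n : ℕ) (U : ℕ → Ω → ℝ) (A : ℕ → Set Ω) (i : ℕ) (ω : Ω) :
    potential n U A (i + 1) ω + loss n U A i ω =
      count A i ω + gain (value (n - (i + 1))) (state U A i ω) (U i ω) := by
  rw [potential, loss, count_succ]; ring

lemma abs_potential_le (n : ℕ) (U : ℕ → Ω → ℝ) (A : ℕ → Set Ω) (i : ℕ) (ω : Ω) :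
    |potential n U A i ω| ≤ i + n := by
  have h1 := count_nonneg A i ω
  have h2 := count_le A i ω
  have h3 := value_nonneg (n - i) (state U A i ω)
  have h4 := value_le (n - i) (state U A i ω)
  have h5 : ((n - i : ℕ) : ℝ) ≤ n := by exact_mod_cast Nat.sub_le n i
  unfold potential
  rw [abs_of_nonneg (by linarith)]
  linarith

lemma abs_count_add_gain_le (n : ℕ) (A : ℕ → Set Ω) (i k : ℕ) (hk : k ≤ n) (ω : Ω) (r u : ℝ) :
    |count A i ω + gain (value k) r u| ≤ i + (1 + n) := by
  have h1 := count_nonneg A i ω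
  have h2 := count_le A i ω
  have h3 := (value_nonneg k r).trans (le_gain _ r u)
  have h4 := gain_le (value_le k) r u
  have h5 : (k : ℝ) ≤ n := by exact_mod_cast hk
  rw [abs_of_nonneg (by linarith)]
  linarith

variable [m0 : MeasurableSpace Ω] {μ : Measure Ω}

lemma IsUniformOffers.measurable (hU : IsUniformOffers μ n U m) (i : ℕ) : Measurable (U i) :=
  (hU.meas i).mono (hU.le _) le_rfl

lemma measurable_potential (hU : IsUniformOffers μ n U m) (hA : IsFeasible U m A) (i : ℕ) :
    Measurable (potential n U A i) :=
  ((measurable_count hU.mono hA.adapted i).mono (hU.le i) le_rfl).add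
    ((measurable_value _).comp
      ((measurable_state hU.mono hU.meas hA.adapted i).mono (hU.le i) le_rfl))

variable [IsProbabilityMeasure μ]

lemma integrable_of_abs_le {f : Ω → ℝ} (hf : Measurable f) {c : ℝ} (h : ∀ ω, |f ω| ≤ c) :
    Integrable f μ :=
  Integrable.of_bound hf.aestronglyMeasurable c (.of_forall h)

lemma IsUniformOffers.map_prodMk (hU : IsUniformOffers μ n U m) (hi : i < n) {β : Type*}
    [MeasurableSpace β] {W : Ω → β} (hW : Measurable[m i] W) :
    μ.map (fun ω => (W ω, U i ω)) = (μ.map W).prod uniform01 := by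
  have hW0 : Measurable W := hW.mono (hU.le i) le_rfl
  rw [← hU.map i hi]
  refine (indepFun_iff_map_prod_eq_prod_map_map hW0.aemeasurable
    (hU.measurable i).aemeasurable).1 ?_
  exact indep_of_indep_of_le_left (hU.indep i hi) hW.comap_le

lemma IsUniformOffers.integral_eq (hU : IsUniformOffers μ n U m) (hi : i < n) {β : Type*}
    [MeasurableSpace β] {W : Ω → β} (hW : Measurable[m i] W) {f : β × ℝ → ℝ} (hf : Measurable f)
    (hint : Integrable (fun ω => f (W ω, U i ω)) μ) :
    Integrable (fun ω => ∫ u, f (W ω, u) ∂uniform01) μ ∧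
      ∫ ω, f (W ω, U i ω) ∂μ = ∫ ω, ∫ u, f (W ω, u) ∂uniform01 ∂μ := by
  have hW0 : Measurable W := hW.mono (hU.le i) le_rfl
  have hp := hU.map_prodMk hi hW
  have hWU : Measurable fun ω => (W ω, U i ω) := hW0.prodMk (hU.measurable i)
  have : IsProbabilityMeasure (μ.map W) := Measure.isProbabilityMeasure_map hW0.aemeasurable
  have hint' : Integrable f ((μ.map W).prod uniform01) := by
    rw [← hp, integrable_map_measure hf.aestronglyMeasurable hWU.aemeasurable]
    exact hint
  refine ⟨hint'.integral_prod_left.comp_measurable hW0, ?_⟩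
  rw [← integral_map hWU.aemeasurable hf.aestronglyMeasurable, hp, integral_prod _ hint',
    integral_map hW0.aemeasurable hint'.aestronglyMeasurable.integral_prod_right']

lemma IsUniformOffers.ae_of_ae (hU : IsUniformOffers μ n U m) (hi : i < n) {β : Type*}
    [MeasurableSpace β] {W : Ω → β} (hW : Measurable[m i] W) {p : β × ℝ → Prop}
    (hp : MeasurableSet {x | p x}) (h : ∀ w, ∀ᵐ u ∂uniform01, p (w, u)) :
    ∀ᵐ ω ∂μ, p (W ω, U i ω) := by
  have hW0 : Measurable W := hW.mono (hU.le i) le_rfl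
  have hWU : Measurable fun ω => (W ω, U i ω) := hW0.prodMk (hU.measurable i)
  rw [← ae_map_iff (p := p) hWU.aemeasurable hp, hU.map_prodMk hi hW]
  exact (Measure.ae_prod_iff_ae_ae hp).2 (.of_forall h)

lemma ae_loss_eq_zero_iff (hU : IsUniformOffers μ n U m) (hA : IsFeasible U m A) (hi : i < n) :
    ∀ᵐ ω ∂μ, loss n U A i ω = 0 ↔
      (ω ∈ A i ↔ Take (n - (i + 1)) (state U A i ω) (U i ω)) := by
  filter_upwards [hU.ae_of_ae hi (measurable_state hU.mono hU.meas hA.adapted i)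
    (measurableSet_no_tie (n - (i + 1))) (ae_no_tie _)] with ω h
  exact loss_eq_zero_iff h.1 h.2

/-- Two selections without losses accept the same offers almost surely. -/
lemma ae_eq_of_loss (hU : IsUniformOffers μ n U m) (hA : IsFeasible U m A) (hB : IsFeasible U m B)
    (hA0 : ∀ i < n, loss n U A i =ᵐ[μ] 0) (hB0 : ∀ i < n, loss n U B i =ᵐ[μ] 0) :
    ∀ i < n, A i =ᵐ[μ] B i := by
  have key : ∀ C, IsFeasible U m C → (∀ i < n, loss n U C i =ᵐ[μ] 0) →
      ∀ᵐ ω ∂μ, ∀ i < n, ω ∈ C i ↔ Take (n - (i + 1)) (state U C i ω) (U i ω) := by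
    intro C hC hC0
    rw [ae_all_iff]
    intro i
    by_cases hi : i < n
    · filter_upwards [ae_loss_eq_zero_iff hU hC hi, hC0 i hi] with ω h h' _ using h.1 h'
    · exact .of_forall fun _ h => absurd h hi
  have hs : ∀ᵐ ω ∂μ, ∀ i < n, ω ∈ A i ↔ ω ∈ B i := by
    filter_upwards [key A hA hA0, key B hB hB0] with ω h1 h2
    have hst : ∀ i ≤ n, state U A i ω = state U B i ω := by
      intro i
      induction i with
      | zero => exact fun _ => rfl
      | succ i ih =>
        intro hi
        have e := ih (by omega)
        have : ω ∈ A i ↔ ω ∈ B i := by rw [h1 i hi, h2 i hi, e]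
        by_cases h : ω ∈ A i
        · rw [state_succ_of_mem h, state_succ_of_mem (this.1 h), e]
        · rw [state_succ_of_notMem h, state_succ_of_notMem (mt this.2 h), e]
    intro i hi
    rw [h1 i hi, h2 i hi, hst i hi.le]
  intro i hi
  filter_upwards [hs] with ω h
  exact propext (h i hi)

lemma integrable_potential (hU : IsUniformOffers μ n U m) (hA : IsFeasible U m A) (i : ℕ) :
    Integrable (potential n U A i) μ :=
  integrable_of_abs_le (measurable_potential hU hA i) (abs_potential_le n U A i)

lemma integrable_count_add_gain (hU : IsUniformOffers μ n U m) (hA : IsFeasible U m A) (i : ℕ) :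
    Integrable (fun ω => count A i ω + gain (value (n - (i + 1))) (state U A i ω) (U i ω)) μ := by
  refine integrable_of_abs_le ?_
    fun ω => abs_count_add_gain_le n A i (n - (i + 1)) (Nat.sub_le _ _) ω _ _
  exact ((measurable_count hU.mono hA.adapted i).mono (hU.le i) le_rfl).add
    ((measurable_gain (measurable_value _)).comp
      (((measurable_state hU.mono hU.meas hA.adapted i).mono (hU.le i) le_rfl).prodMk
        (hU.measurable i)))

lemma integrable_loss (hU : IsUniformOffers μ n U m) (hA : IsFeasible U m A) (i : ℕ) :
    Integrable (loss n U A i) μ := by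
  refine ((integrable_count_add_gain hU hA i).sub (integrable_potential hU hA (i + 1))).congr
    (.of_forall fun ω => ?_)
  have := potential_succ_add_loss n U A i ω
  simp only [Pi.sub_apply]
  linarith

lemma value_sub_of_lt (hi : i < n) (r : ℝ) :
    ∫ u, gain (value (n - (i + 1))) r u ∂uniform01 = value (n - i) r := by
  rw [show n - i = n - (i + 1) + 1 by omega]; rfl

/-- Given the past, the offer is a fresh uniform one, and averaging `gain` over it is the Bellman
recursion. -/
lemma integral_potential_succ_add_loss (hU : IsUniformOffers μ n U m) (hA : IsFeasible U m A)
    (hi : i < n) :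
    ∫ ω, potential n U A (i + 1) ω ∂μ + ∫ ω, loss n U A i ω ∂μ = ∫ ω, potential n U A i ω ∂μ := by
  rw [← integral_add (integrable_potential hU hA _) (integrable_loss hU hA i)]
  simp only [potential_succ_add_loss]
  have hW : Measurable[m i] fun ω => (count A i ω, state U A i ω) :=
    (measurable_count hU.mono hA.adapted i).prodMk (measurable_state hU.mono hU.meas hA.adapted i)
  have hf : Measurable fun x : (ℝ × ℝ) × ℝ =>
      x.1.1 + gain (value (n - (i + 1))) x.1.2 x.2 :=
    measurable_fst.fst.add ((measurable_gain (measurable_value _)).comp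
      (measurable_fst.snd.prodMk measurable_snd))
  rw [(hU.integral_eq hi hW hf (integrable_count_add_gain hU hA i)).2]
  refine integral_congr_ae (.of_forall fun ω => ?_)
  simp only
  rw [integral_add (integrable_const _) (integrable_gain_value _ _), value_sub_of_lt hi]
  simp [potential]

lemma integral_count_add_sum_loss (hU : IsUniformOffers μ n U m) (hA : IsFeasible U m A) :
    ∫ ω, count A n ω ∂μ + ∑ i ∈ Finset.range n, ∫ ω, loss n U A i ω ∂μ = value n 2 := by
  have : ∑ i ∈ Finset.range n, ∫ ω, loss n U A i ω ∂μ = ∑ i ∈ Finset.range n,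
      (∫ ω, potential n U A i ω ∂μ - ∫ ω, potential n U A (i + 1) ω ∂μ) :=
    Finset.sum_congr rfl fun i hi => by
      linarith [integral_potential_succ_add_loss hU hA (Finset.mem_range.1 hi)]
  rw [this, Finset.sum_range_sub']
  simp [potential_self, potential_zero]

lemma integral_count_le (hU : IsUniformOffers μ n U m) (hA : IsFeasible U m A) :
    ∫ ω, count A n ω ∂μ ≤ value n 2 := by
  have := integral_count_add_sum_loss hU hA
  have h : 0 ≤ ∑ i ∈ Finset.range n, ∫ ω, loss n U A i ω ∂μ :=
    Finset.sum_nonneg fun i _ => integral_nonneg (loss_nonneg hA n i)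
  linarith

/-- The shortfall from `value n 2` is a sum of integrals of nonnegative losses. -/
lemma integral_count_eq_iff (hU : IsUniformOffers μ n U m) (hA : IsFeasible U m A) :
    ∫ ω, count A n ω ∂μ = value n 2 ↔ ∀ i < n, loss n U A i =ᵐ[μ] 0 := by
  rw [← integral_count_add_sum_loss hU hA, left_eq_add,
    Finset.sum_eq_zero_iff_of_nonneg fun i _ => integral_nonneg (loss_nonneg hA n i)]
  simp only [Finset.mem_range]
  exact forall₂_congr fun i _ =>
    integral_eq_zero_iff_of_nonneg (loss_nonneg hA n i) (integrable_loss hU hA i)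

/-! ### Second moment and variance -/

lemma integrable_indicator_one (hU : IsUniformOffers μ n U m) (hA : IsFeasible U m A) (i : ℕ) :
    Integrable ((A i).indicator fun _ => (1 : ℝ)) μ :=
  (integrable_const 1).indicator (hU.le _ _ (hA.adapted i))

lemma integrable_potential_sq (hU : IsUniformOffers μ n U m) (hA : IsFeasible U m A) (i : ℕ) :
    Integrable (fun ω => potential n U A i ω ^ 2) μ := by
  refine integrable_of_abs_le ((measurable_potential hU hA i).pow_const 2) (c := (i + n) ^ 2)
    fun ω => ?_
  rw [abs_pow]
  exact pow_le_pow_left₀ (abs_nonneg _) (abs_potential_le n U A i ω) 2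

/-- The increment of the second moment of the potential is at most the probability of an
acceptance. -/
lemma integral_potential_sq_succ_le (hU : IsUniformOffers μ n U m) (hA : IsFeasible U m A)
    (hi : i < n) (h0 : loss n U A i =ᵐ[μ] 0) :
    ∫ ω, potential n U A (i + 1) ω ^ 2 ∂μ ≤
      ∫ ω, potential n U A i ω ^ 2 ∂μ + ∫ ω, (A i).indicator (fun _ => (1 : ℝ)) ω ∂μ := by
  set k := n - (i + 1) with hk
  have hW : Measurable[m i] fun ω => (count A i ω, state U A i ω) :=
    (measurable_count hU.mono hA.adapted i).prodMk (measurable_state hU.mono hU.meas hA.adapted i)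
  have hW0 : Measurable fun ω => (count A i ω, state U A i ω) := hW.mono (hU.le i) le_rfl
  -- With count `c`, rejection value `v` and gain `g`, `(c + g) ^ 2 = f + (g - v) ^ 2`. Here `f` is
  -- affine in `g`, so averaging over the offer only replaces `g` by its mean.
  set f : (ℝ × ℝ) × ℝ → ℝ := fun x =>
    x.1.1 ^ 2 - value k x.1.2 ^ 2 + 2 * (x.1.1 + value k x.1.2) * gain (value k) x.1.2 x.2 with hfd
  have hv : Measurable fun x : (ℝ × ℝ) × ℝ => value k x.1.2 :=
    (measurable_value k).comp measurable_fst.snd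
  have hg : Measurable fun x : (ℝ × ℝ) × ℝ => gain (value k) x.1.2 x.2 :=
    (measurable_gain (measurable_value k)).comp (measurable_fst.snd.prodMk measurable_snd)
  have hf : Measurable f := by
    have h1 : Measurable fun x : (ℝ × ℝ) × ℝ => x.1.1 := measurable_fst.fst
    exact ((h1.pow_const 2).sub (hv.pow_const 2)).add (((h1.add hv).const_mul 2).mul hg)
  have hfi : Integrable (fun ω => f ((count A i ω, state U A i ω), U i ω)) μ := by
    refine integrable_of_abs_le (hf.comp (hW0.prodMk (hU.measurable i)))
      (c := i ^ 2 + k ^ 2 + 2 * (i + k) * (1 + k)) fun ω => ?_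
    have h1 := count_nonneg A i ω
    have h2 := count_le A i ω
    have h3 := value_nonneg k (state U A i ω)
    have h4 := value_le k (state U A i ω)
    have h5 := (value_nonneg k _).trans (le_gain _ (state U A i ω) (U i ω))
    have h6 := gain_le (value_le k) (state U A i ω) (U i ω)
    simp only [hfd]
    have h7 := pow_le_pow_left₀ h1 h2 2
    have h8 := pow_le_pow_left₀ h3 h4 2
    have h9 : (count A i ω + value k (state U A i ω)) * gain (value k) (state U A i ω) (U i ω) ≤
      (i + k) * (1 + k) := mul_le_mul (add_le_add h2 h4) h6 h5 (by positivity)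
    have h10 : 0 ≤ (count A i ω + value k (state U A i ω)) *
      gain (value k) (state U A i ω) (U i ω) := by positivity
    have h11 := sq_nonneg (count A i ω)
    have h12 := sq_nonneg (value k (state U A i ω))
    rw [abs_le]
    constructor <;> nlinarith
  have hpt : ∀ᵐ ω ∂μ, potential n U A (i + 1) ω ^ 2 ≤
      f ((count A i ω, state U A i ω), U i ω) + (A i).indicator (fun _ => (1 : ℝ)) ω := by
    filter_upwards [h0] with ω h
    have e := potential_succ_add_loss n U A i ω
    rw [h, Pi.zero_apply, add_zero] at e
    rw [e, ← hk]
    suffices (gain (value k) (state U A i ω) (U i ω) - value k (state U A i ω)) ^ 2 ≤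
        (A i).indicator (fun _ => (1 : ℝ)) ω by simp only [hfd]; linarith
    have hle := le_gain (value k) (state U A i ω) (U i ω)
    by_cases ha : ω ∈ A i
    · rw [loss_of_mem ha, Pi.zero_apply, sub_eq_zero] at h
      rw [Set.indicator_of_mem ha]
      have := value_mono k (hA.next_le i ω ha)
      have h1 : gain (value k) (state U A i ω) (U i ω) - value k (state U A i ω) ≤ 1 := by
        linarith
      exact pow_le_one₀ (by linarith) h1
    · rw [loss_of_notMem ha, Pi.zero_apply] at h
      rw [Set.indicator_of_notMem ha, hk, h]
      simp
  refine (integral_mono_ae (integrable_potential_sq hU hA (i + 1))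
    (hfi.add (integrable_indicator_one hU hA i)) hpt).trans ?_
  rw [integral_add' hfi (integrable_indicator_one hU hA i)]
  obtain ⟨hfi', he⟩ := hU.integral_eq hi hW hf hfi
  rw [he]
  refine add_le_add_left (integral_mono hfi' (integrable_potential_sq hU hA i) fun ω => ?_) _
  simp only [hfd]
  rw [integral_add (integrable_const _) ((integrable_gain_value _ _).const_mul _),
    integral_const_mul, value_sub_of_lt hi]
  simp only [integral_const, probReal_univ, smul_eq_mul, one_mul]
  unfold potential
  -- With `w` the mean of `g`, the average of `f` is `(c + w) ^ 2 - (w - v) ^ 2`.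
  nlinarith [sq_nonneg (value (n - i) (state U A i ω) - value k (state U A i ω))]

lemma integral_count_sq_le (hU : IsUniformOffers μ n U m) (hA : IsFeasible U m A)
    (h0 : ∀ i < n, loss n U A i =ᵐ[μ] 0) :
    ∫ ω, count A n ω ^ 2 ∂μ ≤ value n 2 ^ 2 + ∫ ω, count A n ω ∂μ := by
  have key : ∀ i ≤ n, ∫ ω, potential n U A i ω ^ 2 ∂μ ≤
      value n 2 ^ 2 + ∫ ω, count A i ω ∂μ := by
    intro i
    induction i with
    | zero => simp [potential_zero, count]
    | succ i ih =>
      intro hi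
      have hc : Integrable (count A i) μ := by
        unfold count
        exact integrable_finsetSum _ fun j _ => integrable_indicator_one hU hA j
      simp only [count_succ]
      rw [integral_add hc (integrable_indicator_one hU hA i)]
      linarith [ih (by omega), integral_potential_sq_succ_le hU hA hi (h0 i hi)]
  simpa [potential_self] using key n le_rfl

/-- Without losses the mean equals `value n 2`, so the square in the second moment bound cancels. -/
lemma variance_count_le (hU : IsUniformOffers μ n U m) (hA : IsFeasible U m A)
    (h0 : ∀ i < n, loss n U A i =ᵐ[μ] 0) :
    variance (count A n) μ ≤ ∫ ω, count A n ω ∂μ := by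
  have hm : Measurable (count A n) :=
    (measurable_count hU.mono hA.adapted n).mono (hU.le n) le_rfl
  have hL : MemLp (count A n) 2 μ := by
    refine MemLp.of_bound hm.aestronglyMeasurable n (.of_forall fun ω => ?_)
    rw [Real.norm_eq_abs, abs_of_nonneg (count_nonneg A n ω)]
    exact count_le A n ω
  rw [variance_eq_sub hL]
  have h1 := integral_count_sq_le hU hA h0
  have h2 := (integral_count_eq_iff hU hA).2 h0
  simp only [Pi.pow_apply]
  rw [h2] at h1 ⊢
  linarith

end Selection

/-! ### Unimodality without valleys, and the transform to uniform offers -/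

/-- A selection is unimodal if and only if it has no strict valley. -/
lemma isUnimodalOn_iff {n : ℕ} (x : Fin n → ℝ) (S : Set (Fin n)) :
    IsUnimodalOn x S ↔ ∀ j ∈ S, ∀ l ∈ S, ∀ i ∈ S, j < l → l < i → ¬ (x l < x j ∧ x l < x i) := by
  constructor
  · rintro (rfl | ⟨t, -, h1, h2⟩) j hj l hl i hi hjl hli ⟨h3, h4⟩
    · exact hj
    · rcases le_total l t with h | h
      · exact h3.not_ge (h1 ⟨hj, hjl.le.trans h⟩ ⟨hl, h⟩ hjl.le)
      · exact h4.not_ge (h2 ⟨hl, h⟩ ⟨hi, h.trans hli.le⟩ hli.le)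
  · intro h
    rcases S.eq_empty_or_nonempty with hS | hS
    · exact Or.inl hS
    -- A place of the largest selected value serves as the turning place.
    obtain ⟨t, ht, hmax⟩ := S.toFinite.exists_maximalFor x S hS
    have hmax : ∀ j ∈ S, x j ≤ x t := fun j hj => by
      by_contra! hc
      exact hc.not_ge (hmax hj hc.le)
    refine Or.inr ⟨t, ht, ?_, ?_⟩
    · rintro j ⟨hj, -⟩ l ⟨hl, hlt⟩ hjl
      by_contra! hc
      have h1 : x l < x t := hc.trans_le (hmax j hj)
      exact h j hj l hl t ht (lt_of_le_of_ne hjl fun e => hc.ne (by rw [e]))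
        (lt_of_le_of_ne hlt fun e => h1.ne (by rw [e])) ⟨hc, h1⟩
    · rintro l ⟨hl, hlt⟩ i ⟨hi, -⟩ hli
      by_contra! hc
      have h1 : x l < x t := hc.trans_le (hmax i hi)
      exact h t ht l hl i hi (lt_of_le_of_ne hlt fun e => h1.ne (by rw [e]))
        (lt_of_le_of_ne hli fun e => hc.ne (by rw [e])) ⟨h1, hc⟩

/-- The probability integral transform. -/
lemma map_cdf_eq_uniform01 (ν : Measure ℝ) [IsProbabilityMeasure ν] {F : ℝ → ℝ} (hF : Continuous F)
    (hν : ∀ x, cdf ν x = F x) : ν.map F = uniform01 := by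
  have : IsProbabilityMeasure (ν.map F) := Measure.isProbabilityMeasure_map hF.aemeasurable
  have hreal : ∀ x, ν.real (Set.Iic x) = F x := fun x => by rw [← cdf_eq_real, hν]
  have hmono : Monotone F := fun x y h => by rw [← hν, ← hν]; exact monotone_cdf ν h
  have h0 : ∀ x, 0 ≤ F x := fun x => by rw [← hν]; exact cdf_nonneg ν x
  have h1 : ∀ x, F x ≤ 1 := fun x => by rw [← hν]; exact cdf_le_one ν x
  have hex : ∀ p, 0 < p → p < 1 → ∃ x, F x = p := fun p hp0 hp1 => by
    refine mem_range_of_exists_le_of_exists_ge hF ?_ ?_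
    · obtain ⟨a, ha⟩ := ((tendsto_cdf_atBot ν).eventually (eventually_lt_nhds hp0)).exists
      exact ⟨a, by rw [← hν]; exact ha.le⟩
    · obtain ⟨b, hb⟩ := ((tendsto_cdf_atTop ν).eventually (eventually_gt_nhds hp1)).exists
      exact ⟨b, by rw [← hν]; exact hb.le⟩
  refine Measure.eq_of_cdf _ _ ?_
  ext p
  rw [cdf_eq_real, cdf_eq_real, map_measureReal_apply hF.measurable measurableSet_Iic]
  have hu : uniform01.real (Set.Iic p) = volume.real (Set.Iic p ∩ Set.Icc 0 1) := by
    rw [uniform01, measureReal_restrict_apply measurableSet_Iic]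
  rw [hu]
  rcases lt_or_ge p 0 with hp | hp
  · have e1 : F ⁻¹' Set.Iic p = ∅ := by
      ext x; simp only [Set.mem_preimage, Set.mem_Iic, Set.mem_empty_iff_false, iff_false, not_le]
      exact hp.trans_le (h0 x)
    have e2 : Set.Iic p ∩ Set.Icc 0 1 = ∅ := by
      ext x; simp only [Set.mem_inter_iff, Set.mem_Iic, Set.mem_Icc, Set.mem_empty_iff_false,
        iff_false]
      intro h; linarith [h.1, h.2.1]
    rw [e1, e2]; simp
  rcases le_or_gt 1 p with hp1 | hp1
  · have e1 : F ⁻¹' Set.Iic p = Set.univ := by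
      ext x; simpa using (h1 x).trans hp1
    have e2 : Set.Iic p ∩ Set.Icc 0 1 = Set.Icc 0 1 :=
      Set.inter_eq_right.2 fun x hx => hx.2.trans hp1
    rw [e1, e2]; simp
  have e2 : Set.Iic p ∩ Set.Icc 0 1 = Set.Icc 0 p := by
    ext x; simp only [Set.mem_inter_iff, Set.mem_Iic, Set.mem_Icc]
    constructor
    · exact fun h => ⟨h.2.1, h.1⟩
    · exact fun h => ⟨h.2, h.1, h.2.trans hp1.le⟩
  rw [e2, Real.volume_real_Icc_of_le hp, sub_zero]
  refine le_antisymm ?_ ?_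
  -- `F` may be flat at level `p`, so a point at a level `q > p` is used to bound the sublevel set
  -- from the right.
  · refine le_of_forall_gt_imp_ge_of_dense fun q hq => ?_
    rcases le_or_gt 1 q with hq1 | hq1
    · exact measureReal_le_one.trans hq1
    obtain ⟨x, hx⟩ := hex q (hp.trans_lt hq) hq1
    rw [← hx, ← hreal]
    refine measureReal_mono fun y hy => ?_
    by_contra! hc
    have hxy : x < y := by simpa using hc
    have := hmono hxy.le
    have hy' : F y ≤ p := hy
    linarith
  · rcases hp.eq_or_lt with rfl | hp0
    · exact measureReal_nonneg
    obtain ⟨x, hx⟩ := hex p hp0 hp1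
    nth_rewrite 1 [← hx]
    rw [← hreal]
    exact measureReal_mono fun y hy => (hmono hy).trans hx.le

/-! ### Selections without valleys and the greedy rule -/

section Greedy

variable {Ω : Type*}

/-- Only feasible offers are accepted, if no accepted offer lies strictly below both an earlier and
a later accepted offer. -/
lemma next_le_of_no_valley {U : ℕ → Ω → ℝ} {A : ℕ → Set Ω} {ω : Ω}
    (hU : ∀ i, U i ω ∈ Set.Icc (0 : ℝ) 1)
    (h : ∀ j l i, j < l → l < i → ω ∈ A j → ω ∈ A l → ω ∈ A i → ¬ (U l ω < U j ω ∧ U l ω < U i ω))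
    (i : ℕ) (hi : ω ∈ A i) : next (state U A i ω) (U i ω) ≤ state U A i ω := by
  -- Invariant: a state at least 1 is the initial one or records an accepted value; a state below 1
  -- records an accepted value lying strictly below an earlier one, so a larger acceptance would
  -- complete a valley.
  have step : ∀ i, ((1 ≤ state U A i ω ∧ (state U A i ω = 2 ∨
        ∃ j < i, ω ∈ A j ∧ U j ω = 2 - state U A i ω)) ∨
      (state U A i ω < 1 ∧ ∃ j l, j < l ∧ l < i ∧ ω ∈ A j ∧ ω ∈ A l ∧ U l ω = state U A i ω ∧
        U l ω < U j ω)) → ω ∈ A i → next (state U A i ω) (U i ω) ≤ state U A i ω := by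
    rintro i hinv hi
    have := (hU i).2
    unfold next
    split_ifs with h2
    · exact h2
    · rcases hinv with ⟨h1, -⟩ | ⟨h1, j, l, hjl, hli, hj, hl, e, hlt⟩
      · linarith
      · by_contra! hc
        exact h j l i hjl hli hj hl hi ⟨hlt, by rwa [e]⟩
  refine step i ?_ hi
  clear hi
  induction i with
  | zero => exact Or.inl (by simp [state])
  | succ i ih =>
    by_cases hi : ω ∈ A i
    · have hle := step i ih hi
      obtain ⟨hu0, hu1⟩ := hU i
      rw [state_succ_of_mem hi]
      unfold next at hle ⊢
      split_ifs at hle ⊢ with h2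
      · exact Or.inl ⟨by linarith, Or.inr ⟨i, i.lt_succ_self, hi, by ring⟩⟩
      -- The peak value 1 has `2 - u = u`; its state 1 counts as climbing.
      · rcases hu1.eq_or_lt with hu | hu
        · exact Or.inl ⟨hu.ge, Or.inr ⟨i, i.lt_succ_self, hi, by linarith⟩⟩
        · refine Or.inr ⟨hu, ?_⟩
          rcases ih with ⟨h1, h3 | ⟨j, hj, hjA, e⟩⟩ | ⟨h1, j, l, hjl, hli, hj, hl, e, hlt⟩
          · linarith
          · exact ⟨j, i, hj, i.lt_succ_self, hjA, hi, rfl, by linarith⟩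
          · exact ⟨j, i, hjl.trans hli, i.lt_succ_self, hj, hi, rfl, by linarith⟩
    · rw [state_succ_of_notMem hi]
      rcases ih with ⟨h1, h3 | ⟨j, hj, hjA, e⟩⟩ | ⟨h1, j, l, hjl, hli, hj, hl, e, hlt⟩
      · exact Or.inl ⟨h1, Or.inl h3⟩
      · exact Or.inl ⟨h1, Or.inr ⟨j, by omega, hjA, e⟩⟩
      · exact Or.inr ⟨h1, j, l, hjl, by omega, hj, hl, e, hlt⟩

open Classical in
/-- The state at time `i`, when every offer with a strictly positive advantage is accepted. -/
noncomputable def greedyState (n : ℕ) (U : ℕ → Ω → ℝ) : ℕ → Ω → ℝ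
  | 0 => fun _ => 2
  | i + 1 => fun ω =>
    if Take (n - (i + 1)) (greedyState n U i ω) (U i ω) then next (greedyState n U i ω) (U i ω)
    else greedyState n U i ω

/-- The offer at time `i` has a strictly positive advantage. -/
def greedy (n : ℕ) (U : ℕ → Ω → ℝ) (i : ℕ) : Set Ω :=
  {ω | Take (n - (i + 1)) (greedyState n U i ω) (U i ω)}

variable {n : ℕ} {U : ℕ → Ω → ℝ}

lemma greedyState_succ_of_mem {i : ℕ} {ω : Ω} (h : ω ∈ greedy n U i) :
    greedyState n U (i + 1) ω = next (greedyState n U i ω) (U i ω) := if_pos h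

lemma greedyState_succ_of_notMem {i : ℕ} {ω : Ω} (h : ω ∉ greedy n U i) :
    greedyState n U (i + 1) ω = greedyState n U i ω := if_neg h

lemma greedyState_succ_lt {i : ℕ} {ω : Ω} (h : ω ∈ greedy n U i) :
    greedyState n U (i + 1) ω < greedyState n U i ω := by
  rw [greedyState_succ_of_mem h]
  exact h.1

lemma antitone_greedyState (n : ℕ) (U : ℕ → Ω → ℝ) (ω : Ω) :
    Antitone fun i => greedyState n U i ω := by
  refine antitone_nat_of_succ_le fun i => ?_
  by_cases h : ω ∈ greedy n U i
  · exact (greedyState_succ_lt h).le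
  · exact (greedyState_succ_of_notMem h).le

/-- Each greedy acceptance lowers the state strictly, so even weak valleys are excluded. This is
needed because `F` may turn strict inequalities between observations into equalities. -/
lemma greedy_no_valley {ω : Ω} (hU : ∀ i, U i ω ∈ Set.Icc (0 : ℝ) 1) {j l i : ℕ} (hjl : j < l)
    (hli : l < i) (hj : ω ∈ greedy n U j) (hl : ω ∈ greedy n U l) (hi : ω ∈ greedy n U i) :
    ¬ (U l ω ≤ U j ω ∧ U l ω ≤ U i ω) := by
  rintro ⟨h1, h2⟩
  have h3 := (greedyState_succ_lt hl).trans_le (antitone_greedyState n U ω hjl)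
  have h4 := (greedyState_succ_lt hi).trans_le (antitone_greedyState n U ω hli)
  simp only [Nat.succ_eq_add_one, greedyState_succ_of_mem hl, greedyState_succ_of_mem hj,
    greedyState_succ_of_mem hi] at h3 h4
  have b1 := (hU j).2
  have b2 := (hU l).2
  have b3 := (hU i).2
  unfold next at h3 h4
  split_ifs at h3 h4 <;> linarith

lemma measurableSet_greedy {m : ℕ → MeasurableSpace Ω} (hm : Monotone m)
    (hU : ∀ i, Measurable[m (i + 1)] (U i)) (n i : ℕ) : MeasurableSet[m (i + 1)] (greedy n U i) := by
  have key : ∀ i, Measurable[m i] (greedyState n U i) →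
      MeasurableSet[m (i + 1)] (greedy n U i) := fun i h =>
    ((h.mono (hm i.le_succ) le_rfl).prodMk (hU i)) (measurableSet_take (n - (i + 1)))
  refine key i ?_
  induction i with
  | zero => exact @measurable_const _ _ _ (m 0) _
  | succ i ih =>
    have ih' : Measurable[m (i + 1)] (greedyState n U i) := ih.mono (hm i.le_succ) le_rfl
    have h : Measurable[m (i + 1)] fun ω => next (greedyState n U i ω) (U i ω) :=
      measurable_next.comp (ih'.prodMk (hU i))
    classical
    exact Measurable.ite (m := m (i + 1)) (p := (· ∈ greedy n U i)) (key i ih) h ih'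

end Greedy

/-! ### Transfer between observations and uniform offers -/

section Observations

variable {Ω : Type*} {n : ℕ}

/-- The observation at time `i`, transformed to a uniform one by its distribution function. -/
noncomputable def offer (F : ℝ → ℝ) (X : Fin n → Ω → ℝ) (i : ℕ) (ω : Ω) : ℝ :=
  -- The default 0 keeps all offers in the unit interval and measurable; it is never accepted.
  if h : i < n then F (X ⟨i, h⟩ ω) else 0

/-- The σ-field generated by the observations before time `i`. -/
abbrev past (X : Fin n → Ω → ℝ) (i : ℕ) : MeasurableSpace Ω :=
  ⨆ j ∈ {j : Fin n | (j : ℕ) < i}, MeasurableSpace.comap (X j) inferInstance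

/-- A finite sequence of events, continued by the empty event. -/
def extend (a : Fin n → Set Ω) (i : ℕ) : Set Ω := {ω | ∃ h : i < n, ω ∈ a ⟨i, h⟩}

lemma history_eq_past (X : Fin n → Ω → ℝ) (i : Fin n) : history X i = past X (i + 1) := by
  refine iSup_congr fun j => iSup_congr_Prop ?_ fun _ => rfl
  rw [Set.mem_ofPred_eq, Nat.lt_succ_iff, Fin.le_def]

lemma past_mono (X : Fin n → Ω → ℝ) : Monotone (past X) := fun _ _ h =>
  biSup_mono fun _ hj => lt_of_lt_of_le (α := ℕ) hj h

lemma measurable_offer {F : ℝ → ℝ} (hF : Continuous F) (X : Fin n → Ω → ℝ) (i : ℕ) :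
    Measurable[past X (i + 1)] (offer F X i) := by
  unfold offer
  split_ifs with h
  · refine hF.measurable.comp (Measurable.of_comap_le ?_)
    exact le_biSup (fun j => MeasurableSpace.comap (X j) inferInstance)
      (show (⟨i, h⟩ : Fin n) ∈ {j : Fin n | (j : ℕ) < i + 1} from Nat.lt_succ_self i)
  · exact @measurable_const _ _ _ (past X (i + 1)) _

lemma isUniformOffers_offer [m0 : MeasurableSpace Ω] {μ : Measure Ω} [IsProbabilityMeasure μ]
    {X : Fin n → Ω → ℝ} (hX : ∀ i, Measurable (X i)) (hindep : iIndepFun X μ) {F : ℝ → ℝ}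
    (hF : Continuous F) (hdist : ∀ i x, cdf (μ.map (X i)) x = F x) :
    IsUniformOffers μ n (offer F X) (past X) where
  le i := iSup₂_le fun j _ => (hX j).comap_le
  mono := past_mono X
  mem i ω := by
    unfold offer
    split_ifs with h
    · rw [← hdist ⟨i, h⟩]
      exact ⟨cdf_nonneg _ _, cdf_le_one _ _⟩
    · simp
  meas := measurable_offer hF X
  map i hi := by
    have : IsProbabilityMeasure (μ.map (X ⟨i, hi⟩)) :=
      Measure.isProbabilityMeasure_map (hX _).aemeasurable
    rw [← map_cdf_eq_uniform01 (μ.map (X ⟨i, hi⟩)) hF (hdist _),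
      Measure.map_map hF.measurable (hX _)]
    congr 1
    funext ω
    exact dif_pos hi
  indep i hi := by
    have h := indep_iSup_of_disjoint (fun j => (hX j).comap_le) hindep.iIndep
      (S := {j : Fin n | (j : ℕ) < i}) (T := {⟨i, hi⟩}) (by simp)
    refine indep_of_indep_of_le_right h ?_
    have e : offer F X i = F ∘ X ⟨i, hi⟩ := funext fun ω => dif_pos hi
    rw [e, ← MeasurableSpace.comap_comp]
    simp only [Set.mem_singleton_iff, iSup_iSup_eq_left]
    exact MeasurableSpace.comap_mono hF.measurable.comap_le

lemma Policy.count_extend {X : Fin n → Ω → ℝ} (π : Policy X) :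
    count (extend π.accept) n = π.length := by
  classical
  funext ω
  unfold count Policy.length
  rw [Finset.sum_range]
  refine Finset.sum_congr rfl fun i _ => ?_
  have e : extend π.accept i = π.accept i := by
    ext ω; exact ⟨fun h => h.2, fun h => ⟨i.2, h⟩⟩
  rw [e]

lemma Policy.isFeasible {X : Fin n → Ω → ℝ} (π : Policy X) {F : ℝ → ℝ} (hF : Monotone F)
    (hU : ∀ i ω, offer F X i ω ∈ Set.Icc (0 : ℝ) 1) :
    IsFeasible (offer F X) (past X) (extend π.accept) where
  adapted i := by
    by_cases h : i < n
    · have e : extend π.accept i = π.accept ⟨i, h⟩ := by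
        ext ω; exact ⟨fun h => h.2, fun h' => ⟨h, h'⟩⟩
      rw [e]
      have := π.adapted ⟨i, h⟩
      rwa [history_eq_past] at this
    · have e : extend π.accept i = ∅ := by
        ext ω; exact ⟨fun h' => h h'.1, fun h' => h'.elim⟩
      rw [e]
      exact @MeasurableSet.empty _ (past X (i + 1))
  next_le i ω hi := by
    refine next_le_of_no_valley (fun i => hU i ω) ?_ i hi
    rintro j l i hjl hli ⟨hjn, hj⟩ ⟨hln, hl⟩ ⟨hin, hi⟩ ⟨h1, h2⟩
    simp only [offer, dif_pos hjn, dif_pos hln, dif_pos hin] at h1 h2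
    exact (isUnimodalOn_iff _ _).1 (π.unimodal ω) ⟨j, hjn⟩ hj ⟨l, hln⟩ hl ⟨i, hin⟩ hi hjl hli
      ⟨hF.reflect_lt h1, hF.reflect_lt h2⟩

/-- The policy that accepts every observation with a strictly positive advantage. -/
noncomputable def greedyPolicy (X : Fin n → Ω → ℝ) {F : ℝ → ℝ} (hFc : Continuous F)
    (hF : Monotone F) (hU : ∀ i ω, offer F X i ω ∈ Set.Icc (0 : ℝ) 1) : Policy X where
  accept i := greedy n (offer F X) i
  adapted i := by
    rw [history_eq_past]
    exact measurableSet_greedy (past_mono X) (measurable_offer hFc X) n i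
  unimodal ω := by
    refine (isUnimodalOn_iff _ _).2 ?_
    rintro j hj l hl i hi hjl hli ⟨h1, h2⟩
    refine greedy_no_valley (fun i => hU i ω) hjl hli hj hl hi ?_
    simp only [offer, Fin.is_lt, dif_pos]
    exact ⟨hF h1.le, hF h2.le⟩

lemma state_extend_greedy (U : ℕ → Ω → ℝ) (ω : Ω) {i : ℕ} (hi : i ≤ n) :
    state U (extend fun i : Fin n => greedy n U i) i ω = greedyState n U i ω := by
  induction i with
  | zero => rfl
  | succ i ih =>
    have ih := ih (by omega)
    by_cases h : ω ∈ greedy n U i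
    · have h' : ω ∈ extend (fun i : Fin n => greedy n U i) i := ⟨hi, h⟩
      rw [greedyState_succ_of_mem h, state_succ_of_mem h', ih]
    · rw [greedyState_succ_of_notMem h, state_succ_of_notMem fun h' => h h'.2, ih]

lemma integral_length_greedyPolicy [MeasurableSpace Ω] {μ : Measure Ω} [IsProbabilityMeasure μ]
    {X : Fin n → Ω → ℝ} {F : ℝ → ℝ} (hFc : Continuous F) (hF : Monotone F)
    (hU : IsUniformOffers μ n (offer F X) (past X)) :
    ∫ ω, (greedyPolicy X hFc hF hU.mem).length ω ∂μ = value n 2 := by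
  have hA := (greedyPolicy X hFc hF hU.mem).isFeasible hF hU.mem
  rw [← Policy.count_extend, integral_count_eq_iff hU hA]
  intro i hi
  filter_upwards [ae_loss_eq_zero_iff hU hA hi] with ω h
  refine h.2 ?_
  have e : state (offer F X) (extend (greedyPolicy X hFc hF hU.mem).accept) i ω =
    greedyState n (offer F X) i ω := state_extend_greedy _ _ hi.le
  rw [e]
  exact ⟨fun h => h.2, fun h => ⟨hi, h⟩⟩

end Observations

end UnimodalSelection

open UnimodalSelection

theorem theorem2 {Ω : Type*} [MeasurableSpace Ω] (μ : Measure Ω) [IsProbabilityMeasure μ]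
    (n : ℕ) (hn : 1 ≤ n) (X : Fin n → Ω → ℝ) (hX : ∀ i, Measurable (X i))
    (hindep : iIndepFun X μ)
    (F : ℝ → ℝ) (hF : Continuous F) (hdist : ∀ i x, cdf (μ.map (X i)) x = F x) :
    (∃ π : UnimodalSelection.Policy X, π.IsOptimal μ) ∧
    (∀ π π' : UnimodalSelection.Policy X, π.IsOptimal μ → π'.IsOptimal μ →
      ∀ i, π.accept i =ᵐ[μ] π'.accept i) ∧
    (∀ π : UnimodalSelection.Policy X, π.IsOptimal μ →
      variance π.length μ ≤ ∫ ω, π.length ω ∂μ ∧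
      ∫ ω, π.length ω ∂μ < 2 * Real.sqrt n) := by
  have hmono : Monotone F := fun x y h => by
    rw [← hdist ⟨0, hn⟩, ← hdist ⟨0, hn⟩]; exact monotone_cdf _ h
  have hU := isUniformOffers_offer hX hindep hF hdist
  have hfeas := fun π : Policy X => π.isFeasible hmono hU.mem
  have hle : ∀ π : Policy X, ∫ ω, π.length ω ∂μ ≤ value n 2 := fun π => by
    rw [← π.count_extend]; exact integral_count_le hU (hfeas π)
  have hgreedy := integral_length_greedyPolicy hF hmono hU
  have hopt : ∀ π : Policy X, π.IsOptimal μ → ∫ ω, π.length ω ∂μ = value n 2 := fun π hπ =>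
    le_antisymm (hle π) (hgreedy ▸ hπ _)
  have hloss : ∀ π : Policy X, π.IsOptimal μ →
      ∀ i < n, loss n (offer F X) (extend π.accept) i =ᵐ[μ] 0 := fun π hπ => by
    rw [← integral_count_eq_iff hU (hfeas π), π.count_extend]; exact hopt π hπ
  refine ⟨⟨greedyPolicy X hF hmono hU.mem, fun π => hgreedy ▸ hle π⟩, fun π π' hπ hπ' i => ?_,
    fun π hπ => ⟨?_, ?_⟩⟩
  · have e : ∀ π : Policy X, extend π.accept i = π.accept i := fun π => by
      ext ω; exact ⟨fun h => h.2, fun h => ⟨i.2, h⟩⟩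
    rw [← e π, ← e π']
    exact ae_eq_of_loss hU (hfeas π) (hfeas π') (hloss π hπ) (hloss π' hπ') i i.2
  · rw [← π.count_extend]
    exact variance_count_le hU (hfeas π) (hloss π hπ)
  · rw [hopt π hπ]
    exact value_two_lt hn
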